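/- Let $\mathbb H$ be the skew field of quaternions, $\mathbb B=\{q\in\mathbb H:|q|<1\}$, and let $\mathcal D$ be the ring of everywhere convergent power series $f(q)=\sum_{n\ge 0} q^n a_n$, $a_n\in\mathbb H$ (the regular functions $\mathbb H\to\mathbb H$), with the regular product $f*g(q)=\sum_n q^n\sum_{k=0}^n a_kb_{n-k}$ for $g(q)=\sum_n q^nb_n$. Put $f^c(q)=\sum_n q^n\bar a_n$ and $f^s=f*f^c$. Let $\mathcal L$ be the division ring of left quotients $f^{-*}*g$ ($f,g\in\mathcal D$, $f\ne 0$) of $\mathcal D$; the quotient $f^{-*}*g$ is regarded as the function $q\mapsto f^s(q)^{-1}\,(f^c*g)(q)$, defined where $f^s(q)\neq 0$ for some representation of the quotient (the value does not depend on the representation). For $A=\begin{pmatrix}a&c\\ b&d\end{pmatrix}\in GL(2,\mathbb H)$ and $f\in\mathcal L$ put $f.A=(fc+d)^{-*}*(fa+b)$, and let $\mathcal F_A(q)=(qc+d)^{-*}*(qa+b)$ be the regular fractional transformation associated to $A$; let $\mathcal G=\{\mathcal F_A: A\in GL(2,\mathbb H)\}$. Let $SL(2,\mathbb H)$ be the group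 of quaternionic $2\times2$ matrices of Dieudonné determinant $1$, and $Sp(1,1)=\{C\in GL(2,\mathbb H):\overline C^{\,t}HC=H\}$ with $H=\begin{pmatrix}1&0\\0&-1\end{pmatrix}$. For every $A\in SL(2,\mathbb H)$ the following are equivalent: 1. $\mathcal F_A$ is defined on $\mathbb B$ and maps $\mathbb B$ onto itself, i.e. $\mathcal F_A(\mathbb B)=\mathbb B$; 2. $A\in Sp(1,1)$; 3. there exist $u\in\partial\mathbb B$ and $a\in\mathbb B$ such that $\mathcal F_A(q)=(1-q\bar a)^{-*}*(q-a)u$ for all $q\in\mathbb B$; 4. there exists exactly one pair $(u,a)\in\partial\mathbb B\times\mathbb B$ with the property in 3. Moreover, the set $\mathcal M=\{f\in\mathcal G: f \text{ is defined on } \mathbb B,\ f(\mathbb B)=\mathbb B\}$ of regular Moebius transformations is the orbit $\{\mathrm{id}.A: A\in Sp(1,1)\}$ of the identity function $\mathrm{id}(q)=q$ under $Sp(1,1)$. -/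

import Mathlib

open scoped Quaternion Matrix nonZeroDivisors

noncomputable section

namespace RegularQuaternionic

/-- The ring `(𝓓_∞, +, *)` of regular functions `ℍ → ℍ`, identified with the everywhere
convergent power series `∑ qⁿ aₙ` (coefficients on the right).  The indeterminate of `ℍ⟦X⟧` is
central, so the product of `ℍ⟦X⟧` is the regular product: `cₙ = ∑ₖ aₖ bₙ₋ₖ`. -/
def Entire : Subring (PowerSeries ℍ[ℝ]) where
  carrier := {f | ∀ q : ℍ[ℝ], Summable fun n : ℕ => q ^ n * PowerSeries.coeff n f}
  zero_mem' := fun q => by simp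
  one_mem' := fun q => by
    refine summable_of_ne_finset_zero (s := {0}) fun n hn => ?_
    have : n ≠ 0 := by simpa using hn
    simp [PowerSeries.coeff_one, this]
  add_mem' := fun {f g} hf hg q => by
    simpa [mul_add] using (hf q).add (hg q)
  neg_mem' := fun {f} hf q => by
    simpa using (hf q).neg
  mul_mem' := fun {f g} hf hg q => by
    have h := fun {f : PowerSeries ℍ[ℝ]}
      (hf : ∀ q : ℍ[ℝ], Summable fun n : ℕ => q ^ n * PowerSeries.coeff n f) =>
        summable_norm_iff.mpr (hf q)
    have h1 : Summable fun n => ‖‖q‖ ^ n * ‖PowerSeries.coeff n f‖‖ := by simpa using h hf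
    have h2 : Summable fun n => ‖‖q‖ ^ n * ‖PowerSeries.coeff n g‖‖ := by simpa using h hg
    refine Summable.of_norm_bounded
      (summable_norm_sum_mul_antidiagonal_of_summable_norm h1 h2).of_norm fun n => ?_
    rw [PowerSeries.coeff_mul, Finset.mul_sum]
    refine (norm_sum_le _ _).trans (Finset.sum_le_sum fun kl hkl => ?_)
    rw [← Finset.HasAntidiagonal.mem_antidiagonal.mp hkl, pow_add, norm_mul, norm_mul, norm_mul, norm_pow, norm_pow]
    exact le_of_eq (by ring)

/-- The `n`-th coefficient of the power series expansion. -/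
def coef (f : Entire) (n : ℕ) : ℍ[ℝ] := PowerSeries.coeff n f.1

/-- The value `f(q) = ∑ qⁿ aₙ`. -/
def value (f : Entire) (q : ℍ[ℝ]) : ℍ[ℝ] := ∑' n : ℕ, q ^ n * coef f n

theorem coef_ext {f g : Entire} (h : ∀ n, coef f n = coef g n) : f = g :=
  Subtype.ext (PowerSeries.ext h)

theorem coef_mul (f g : Entire) (n : ℕ) :
    coef (f * g) n = ∑ p ∈ Finset.HasAntidiagonal.antidiagonal n, coef f p.1 * coef g p.2 :=
  PowerSeries.coeff_mul n f.1 g.1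

theorem summable_value (f : Entire) (q : ℍ[ℝ]) :
    Summable fun n : ℕ => ‖q ^ n * coef f n‖ :=
  summable_norm_iff.mpr (f.2 q)

/-- The constant function `a`. -/
def const (a : ℍ[ℝ]) : Entire :=
  ⟨PowerSeries.C a, fun q => by
    refine summable_of_ne_finset_zero (s := {0}) fun n hn => ?_
    have : n ≠ 0 := by simpa using hn
    simp [PowerSeries.coeff_C, this]⟩

/-- The identity function `q ↦ q`. -/
def ident : Entire :=
  ⟨PowerSeries.X, fun q => by
    refine summable_of_ne_finset_zero (s := {1}) fun n hn => ?_
    have : n ≠ 1 := by simpa using hn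
    simp [PowerSeries.coeff_X, this]⟩

/-- The regular conjugate `fᶜ(q) = ∑ qⁿ āₙ`. -/
def conj (f : Entire) : Entire :=
  ⟨PowerSeries.mk fun n => star (coef f n), fun q => by
    refine Summable.of_norm ?_
    simpa using summable_value f q⟩

/-- The symmetrization `fˢ = f * fᶜ`. -/
def symm (f : Entire) : Entire := f * conj f

@[simp] theorem coef_conj (f : Entire) (n : ℕ) : coef (conj f) n = star (coef f n) :=
  PowerSeries.coeff_mk n fun n => star (coef f n)

theorem conj_mul (f g : Entire) : conj (f * g) = conj g * conj f := by
  refine coef_ext fun n => ?_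
  rw [coef_conj, coef_mul, coef_mul, star_sum, ← Finset.Nat.sum_antidiagonal_swap]
  simp

theorem conj_conj (f : Entire) : conj (conj f) = f := coef_ext fun n => by simp

theorem star_coef_symm (f : Entire) (n : ℕ) : star (coef (symm f) n) = coef (symm f) n := by
  rw [← coef_conj, symm, conj_mul, conj_conj]

theorem coef_symm_comm (f : Entire) (n : ℕ) (a : ℍ[ℝ]) : Commute (coef (symm f) n) a := by
  rw [Quaternion.star_eq_self.mp (star_coef_symm f n)]
  exact Quaternion.coe_commute _ a

theorem symm_comm (f g : Entire) : symm f * g = g * symm f := by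
  refine coef_ext fun n => ?_
  rw [coef_mul, coef_mul, ← Finset.Nat.sum_antidiagonal_swap]
  exact Finset.sum_congr rfl fun p _ => (coef_symm_comm f _ _).eq

theorem conj_mul_self (f : Entire) : conj f * f = symm f := by
  by_cases hf : f = 0
  · subst hf; simp [symm]
  · refine mul_left_cancel₀ hf ?_
    rw [← symm_comm f f, symm, mul_assoc]

theorem conj_ne_zero {f : Entire} (hf : f ≠ 0) : conj f ≠ 0 := fun h => hf <| by
  refine coef_ext fun n => star_eq_zero.mp ?_
  rw [← coef_conj, h]
  exact map_zero (PowerSeries.coeff n)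

theorem symm_ne_zero {f : Entire} (hf : f ≠ 0) : symm f ≠ 0 :=
  mul_ne_zero hf (conj_ne_zero hf)

/-- The Ore condition `fˢ * g = (g * fᶜ) * f`. -/
instance : OreLocalization.OreSet (nonZeroDivisors Entire) :=
  OreLocalization.oreSetOfNoZeroDivisors
    (fun g f => g * conj f.1)
    (fun _ f => ⟨symm f.1, mem_nonZeroDivisors_of_ne_zero
      (symm_ne_zero (nonZeroDivisors.ne_zero f.2))⟩)
    (fun g f => by
      change symm f.1 * g = g * conj f.1 * f.1
      rw [mul_assoc, conj_mul_self, symm_comm])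

/-- The division ring `𝓛_∞` of left regular quotients `f^{-*} * g`: the classical ring of left
quotients of `𝓓_∞`.  Its multiplication is `*` and its inverse is `(·)^{-*}`. -/
abbrev RegQuot : Type := OreLocalization (nonZeroDivisors Entire) Entire

/-- The inclusion `𝓓_∞ → 𝓛_∞`. -/
abbrev toQuot : Entire →+* RegQuot := OreLocalization.numeratorRingHom

/-- `HasValue φ q w`: one can write `φ = f^{-*} * g` with `fˢ(q) ≠ 0` and
`w = fˢ(q)⁻¹ (fᶜ * g)(q)`. -/
def HasValue (φ : RegQuot) (q w : ℍ[ℝ]) : Prop :=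
  ∃ f g : Entire, f ≠ 0 ∧ φ = (toQuot f)⁻¹ * toQuot g ∧ value (symm f) q ≠ 0 ∧
    w = (value (symm f) q)⁻¹ * value (conj f * g) q

theorem toQuot_injective : Function.Injective toQuot :=
  OreLocalization.numeratorHom_inj fun _ h => h.1

theorem value_symm_mul (f g : Entire) (q : ℍ[ℝ]) :
    value (symm f * g) q = value (symm f) q * value g q := by
  unfold value
  rw [tsum_mul_tsum_eq_tsum_sum_antidiagonal_of_summable_norm (summable_value _ q)
    (summable_value _ q)]
  refine tsum_congr fun n => ?_
  rw [coef_mul, Finset.mul_sum]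
  refine Finset.sum_congr rfl fun p hp => ?_
  rw [← Finset.HasAntidiagonal.mem_antidiagonal.mp hp, pow_add, mul_assoc, mul_assoc,
    ← mul_assoc (q ^ p.2), ← ((coef_symm_comm f p.1) (q ^ p.2)).eq, mul_assoc]

/-- The value of a regular quotient does not depend on the representation. -/
theorem HasValue.unique {φ : RegQuot} {q w w' : ℍ[ℝ]} (h : HasValue φ q w) (h' : HasValue φ q w') :
    w = w' := by
  obtain ⟨f, g, hf, rfl, hq, rfl⟩ := h
  obtain ⟨f', g', hf', he, hq', rfl⟩ := h'
  have key : ∀ {f g : Entire}, f ≠ 0 →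
      toQuot (symm f) * ((toQuot f)⁻¹ * toQuot g) = toQuot (conj f * g) := by
    intro f g hf
    have hf0 : toQuot f ≠ 0 := (map_ne_zero_iff _ toQuot_injective).mpr hf
    rw [← conj_mul_self, map_mul, map_mul, mul_assoc, mul_inv_cancel_left₀ hf0]
  have e : symm f' * (conj f * g) = symm f * (conj f' * g') := by
    apply toQuot_injective
    rw [map_mul, ← key hf, map_mul _ (symm f), ← key hf', ← he, ← mul_assoc (toQuot (symm f')),
      ← mul_assoc (toQuot (symm f)), ← map_mul, ← map_mul, symm_comm]
  have e' := congrArg (fun h => value h q) e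
  simp only [value_symm_mul] at e'
  have c : value (symm f) q * value (symm f') q = value (symm f') q * value (symm f) q := by
    rw [← value_symm_mul, symm_comm, value_symm_mul]
  rw [inv_mul_eq_iff_eq_mul₀ hq]
  refine mul_left_cancel₀ hq' ?_
  rw [e', ← mul_assoc, ← c, mul_assoc, mul_inv_cancel_left₀ hq']

/-- A regular quotient as a partial function on `ℍ`. -/
def toFun (φ : RegQuot) : ℍ[ℝ] →. ℍ[ℝ] := fun q => ⟨∃ w, HasValue φ q w, fun h => h.choose⟩

theorem mem_toFun {φ : RegQuot} {q w : ℍ[ℝ]} : w ∈ toFun φ q ↔ HasValue φ q w :=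
  ⟨fun ⟨h, e⟩ => e ▸ h.choose_spec, fun h => ⟨⟨w, h⟩, (Exists.choose_spec ⟨w, h⟩).unique h⟩⟩

/-- The open unit ball `𝔹`. -/
def unitBall : Set ℍ[ℝ] := Metric.ball 0 1

/-- `φ` is defined on the whole of `𝔹` and `φ(𝔹) = 𝔹`. -/
def MapsBallOnto (φ : RegQuot) : Prop :=
  unitBall ⊆ (toFun φ).Dom ∧ (toFun φ).image unitBall = unitBall

/-- The action `f.A = (f c + d)^{-*} * (f a + b)` of `A = (a c; b d)` on regular quotients. -/
def act (f : RegQuot) (A : Matrix.GeneralLinearGroup (Fin 2) ℍ[ℝ]) : RegQuot :=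
  (f * toQuot (const (A.1 0 1)) + toQuot (const (A.1 1 1)))⁻¹ *
    (f * toQuot (const (A.1 0 0)) + toQuot (const (A.1 1 0)))

/-- The regular fractional transformation `𝓕_A(q) = (q c + d)^{-*} * (q a + b)` of
`A = (a c; b d)`. -/
def regFrac (A : Matrix.GeneralLinearGroup (Fin 2) ℍ[ℝ]) : RegQuot :=
  (toQuot (ident * const (A.1 0 1) + const (A.1 1 1)))⁻¹ *
    toQuot (ident * const (A.1 0 0) + const (A.1 1 0))

/-- The set `𝓖` of regular fractional transformations. -/
def regFracs : Set RegQuot := Set.range regFrac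

/-- The set `𝓜` of regular Moebius transformations. -/
def regMoebius : Set RegQuot := {φ ∈ regFracs | MapsBallOnto φ}

/-- The regular quotient `(1 - q ā)^{-*} * (q - a) u`. -/
def moebius (a u : ℍ[ℝ]) : RegQuot :=
  (toQuot (1 - ident * const (star a)))⁻¹ * toQuot ((ident - const a) * const u)

/-- The Dieudonné determinant of a quaternionic `2 × 2` matrix `(x y; z w)`, with values in
`[0, ∞)`: the norm of `x w - x z x⁻¹ y` if `x ≠ 0`, and of `z y` if `x = 0`. -/
def dieudonneDet (M : Matrix (Fin 2) (Fin 2) ℍ[ℝ]) : ℝ :=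
  open Classical in
  if M 0 0 = 0 then ‖M 1 0 * M 0 1‖
  else ‖M 0 0 * M 1 1 - M 0 0 * M 1 0 * (M 0 0)⁻¹ * M 0 1‖

/-- `SL(2, ℍ)`: the invertible matrices with Dieudonné determinant `1`. -/
def SL2 : Set (Matrix.GeneralLinearGroup (Fin 2) ℍ[ℝ]) := {A | dieudonneDet A.1 = 1}

/-- The matrix `H = diag(1, -1)`. -/
def formH : Matrix (Fin 2) (Fin 2) ℍ[ℝ] := !![1, 0; 0, -1]

/-- The symplectic group `Sp(1,1)` of all `C ∈ GL(2, ℍ)` with `C̄ᵗ H C = H`. -/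
def Sp11 : Subgroup (Matrix.GeneralLinearGroup (Fin 2) ℍ[ℝ]) where
  carrier := {C | C.1ᴴ * formH * C.1 = formH}
  one_mem' := by simp
  mul_mem' := fun {A B} hA hB => by
    change (A.1 * B.1)ᴴ * formH * (A.1 * B.1) = formH
    have hA' : A.1ᴴ * formH * A.1 = formH := hA
    have hB' : B.1ᴴ * formH * B.1 = formH := hB
    calc (A.1 * B.1)ᴴ * formH * (A.1 * B.1) = B.1ᴴ * (A.1ᴴ * formH * A.1) * B.1 := by
          rw [Matrix.conjTranspose_mul]; simp only [mul_assoc]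
      _ = formH := by rw [hA', hB']
  inv_mem' := fun {A} hA => by
    change (A⁻¹).1ᴴ * formH * (A⁻¹).1 = formH
    have hA' : A.1ᴴ * formH * A.1 = formH := hA
    have h1 : A.1 * (A⁻¹).1 = 1 := A.mul_inv
    have h2 : (A⁻¹).1ᴴ * A.1ᴴ = 1 := by rw [← Matrix.conjTranspose_mul, h1]; simp
    calc (A⁻¹).1ᴴ * formH * (A⁻¹).1 = (A⁻¹).1ᴴ * (A.1ᴴ * formH * A.1) * (A⁻¹).1 := by rw [hA']
      _ = ((A⁻¹).1ᴴ * A.1ᴴ) * formH * (A.1 * (A⁻¹).1) := by simp only [mul_assoc]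
      _ = formH := by rw [h1, h2, one_mul, mul_one]

/-- The orbit of `f` under the subgroup `Γ`. -/
def orbit (f : RegQuot) (Γ : Subgroup (Matrix.GeneralLinearGroup (Fin 2) ℍ[ℝ])) : Set RegQuot :=
  {φ | ∃ A ∈ Γ, φ = act f A}

end RegularQuaternionic

end

open RegularQuaternionic

/-! Regular quotients reduce to classical ones. For linear `f` and any `g` of the form `qx + y`, `(f
* g)(q) = f(q) g(f(q)⁻¹ q f(q))` wherever `f(q) ≠ 0`. Taking the left factor to be the conjugate
denominator, with value `h = q c̄ + d̄`, turns both `fˢ(q)` and `(fᶜ * g)(q)` into `h` times a value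
at `p = h⁻¹ q h`; so the quotient at `q` is the classical `(pc + d)⁻¹(pa + b)`. Since `|p| = |q|`
and every `p` in the ball arises this way, the regular and the classical transformation have the
same image of the ball (`mapsBallOnto_linearQuot_iff`).

The classical problem is about the row `(p, 1)A` and the Hermitian form given by `H`. The ball is
preserved exactly when `|pc + d|² - |pa + b|²` is positive precisely on the ball; this forces it to
be `l(1 - |p|²)` with `l > 0`, that is `A H Āᵗ = l H` (`exists_isSimilitude_of_mapsBallOnto`,
`IsSimilitude.mapsBallOnto`). The factor `l` is the Dieudonné determinant, so it is `1` on `SL2`;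
for general `A` a real rescaling makes it `1` without changing the quotient. Dividing by `d` on the
left gives the normal form with parameters `u` and `a`: `a` is its only zero in the ball, and one
further value determines `u`. -/

noncomputable section

namespace RegularQuaternionic

/-! ### Values of entire regular functions -/

theorem coef_const (a : ℍ[ℝ]) (n : ℕ) : coef (const a) n = if n = 0 then a else 0 :=
  PowerSeries.coeff_C n a

theorem const_mul_const (a b : ℍ[ℝ]) : const a * const b = const (a * b) :=
  Subtype.ext (map_mul (PowerSeries.C (R := ℍ[ℝ])) a b).symm

theorem const_neg (a : ℍ[ℝ]) : const (-a) = -const a :=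
  Subtype.ext (map_neg (PowerSeries.C (R := ℍ[ℝ])) a)

theorem const_one : const 1 = 1 :=
  Subtype.ext (map_one (PowerSeries.C (R := ℍ[ℝ])))

theorem mul_ident (f : Entire) : f * ident = ident * f :=
  Subtype.ext (PowerSeries.commute_X f.1).eq

theorem coef_add (f g : Entire) (n : ℕ) : coef (f + g) n = coef f n + coef g n :=
  map_add (PowerSeries.coeff n) f.1 g.1

theorem coef_const_mul (a : ℍ[ℝ]) (f : Entire) (n : ℕ) : coef (const a * f) n = a * coef f n :=
  PowerSeries.coeff_C_mul n f.1 a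

theorem coef_ident_mul_succ (f : Entire) (n : ℕ) : coef (ident * f) (n + 1) = coef f n :=
  PowerSeries.coeff_succ_X_mul n f.1

theorem coef_ident_mul_zero (f : Entire) : coef (ident * f) 0 = 0 :=
  PowerSeries.coeff_zero_X_mul f.1

theorem summable_pow_mul_coef (f : Entire) (q : ℍ[ℝ]) : Summable fun n : ℕ => q ^ n * coef f n :=
  f.2 q

theorem value_add (f g : Entire) (q : ℍ[ℝ]) : value (f + g) q = value f q + value g q := by
  unfold value
  rw [← (summable_pow_mul_coef f q).tsum_add (summable_pow_mul_coef g q)]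
  exact tsum_congr fun n => by rw [coef_add, mul_add]

theorem value_const (a q : ℍ[ℝ]) : value (const a) q = a := by
  unfold value
  rw [tsum_eq_single 0 fun n hn => by simp [coef_const, hn]]
  simp [coef_const]

theorem value_ident_mul (f : Entire) (q : ℍ[ℝ]) : value (ident * f) q = q * value f q := by
  unfold value
  rw [(summable_pow_mul_coef (ident * f) q).tsum_eq_zero_add, coef_ident_mul_zero, mul_zero, zero_add,
    ← (summable_pow_mul_coef f q).tsum_mul_left]
  exact tsum_congr fun n => by rw [coef_ident_mul_succ, pow_succ', mul_assoc]

/-- The regular polynomial `q x + y`. -/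
def linear (x y : ℍ[ℝ]) : Entire := ident * const x + const y

theorem value_linear (x y q : ℍ[ℝ]) : value (linear x y) q = q * x + y := by
  rw [linear, value_add, value_ident_mul, value_const, value_const]

theorem const_mul_linear (z x y : ℍ[ℝ]) : const z * linear x y = linear (z * x) (z * y) := by
  rw [linear, linear, mul_add, ← mul_assoc, mul_ident, mul_assoc, const_mul_const, const_mul_const]

theorem conj_linear (x y : ℍ[ℝ]) : conj (linear x y) = linear (star x) (star y) := by
  refine coef_ext fun n => ?_
  rw [coef_conj, linear, linear, coef_add, coef_add, coef_const, coef_const]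
  cases n with
  | zero => simp [coef_ident_mul_zero]
  | succ n => rw [coef_ident_mul_succ, coef_ident_mul_succ, coef_const, coef_const]; split_ifs <;> simp

theorem linear_ne_zero {x y q : ℍ[ℝ]} (h : q * x + y ≠ 0) : linear x y ≠ 0 := fun h0 => h <| by
  rw [← value_linear, h0]
  simp [value, coef]

/-- A regular product whose left factor is linear vanishes where that factor does. -/
theorem value_linear_mul_of_root {x y q : ℍ[ℝ]} (h : q * x + y = 0) (f : Entire) :
    value (linear x y * f) q = 0 := by
  rw [linear, add_mul, mul_assoc, value_add, value_ident_mul]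
  unfold value
  rw [← (summable_pow_mul_coef (const x * f) q).tsum_mul_left,
    ← ((summable_pow_mul_coef (const x * f) q).mul_left q).tsum_add
      (summable_pow_mul_coef (const y * f) q)]
  convert tsum_zero with n
  have : q * (q ^ n * (x * coef f n)) + q ^ n * (y * coef f n)
      = q ^ n * ((q * x + y) * coef f n) := by
    rw [← mul_assoc q, ← pow_succ', pow_succ]; noncomm_ring
  rw [coef_const_mul, coef_const_mul, this, h, zero_mul, mul_zero]

/-- The product formula `(f * g)(q) = f(q) g(p)` with `p` the conjugate of `q` by `f(q)`; the
hypothesis states the conjugation without inverses. -/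
theorem value_linear_mul_linear {x y z w q p : ℍ[ℝ]} (hp : q * (q * x + y) = (q * x + y) * p) :
    value (linear x y * linear z w) q = (q * x + y) * (p * z + w) := by
  have e : linear x y * linear z w = ident * linear (x * z) (x * w) + linear (y * z) (y * w) := by
    conv_lhs => rw [linear]
    rw [add_mul, mul_assoc, const_mul_linear, const_mul_linear]
  rw [e, value_add, value_ident_mul, value_linear, value_linear, mul_add _ (p * z), ← mul_assoc _ p,
    ← hp]
  noncomm_ring

/-! ### Linear quotients -/

/-- The regular quotient `(q c + d)^{-*} * (q a + b)`. -/
def linearQuot (a b c d : ℍ[ℝ]) : RegQuot := (toQuot (linear c d))⁻¹ * toQuot (linear a b)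

theorem regFrac_eq_linearQuot (A : Matrix.GeneralLinearGroup (Fin 2) ℍ[ℝ]) :
    regFrac A = linearQuot (A.1 0 0) (A.1 1 0) (A.1 0 1) (A.1 1 1) := rfl

theorem act_ident (A : Matrix.GeneralLinearGroup (Fin 2) ℍ[ℝ]) :
    act (toQuot ident) A = regFrac A := by
  simp only [act, regFrac, map_mul, map_add]

theorem moebius_eq_linearQuot (a u : ℍ[ℝ]) :
    moebius a u = linearQuot u (-(a * u)) (-star a) 1 := by
  have e1 : (1 : Entire) - ident * const (star a) = linear (-star a) 1 := by
    rw [linear, const_neg, const_one]; noncomm_ring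
  have e2 : (ident - const a) * const u = linear u (-(a * u)) := by
    rw [linear, const_neg, ← const_mul_const]; noncomm_ring
  rw [moebius, linearQuot, e1, e2]

theorem linearQuot_mul_left {z : ℍ[ℝ]} (hz : z ≠ 0) (a b c d : ℍ[ℝ]) :
    linearQuot (z * a) (z * b) (z * c) (z * d) = linearQuot a b c d := by
  have h : toQuot (const z) ≠ 0 := by
    refine (map_ne_zero_iff _ toQuot_injective).mpr fun h0 => hz ?_
    rw [← value_const z 0, h0]; simp [value, coef]
  rw [linearQuot, linearQuot, ← const_mul_linear, ← const_mul_linear, map_mul, map_mul, mul_inv_rev,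
    mul_assoc, inv_mul_cancel_left₀ h]

/-- Where a linear quotient in lowest terms is defined, its denominator has no zero. -/
theorem HasValue.denom_ne_zero {a b c d p w : ℍ[ℝ]} (hcd : linear c d ≠ 0)
    (hp : p * c + d = 0 → p * a + b ≠ 0) (h : HasValue (linearQuot a b c d) p w) :
    p * c + d ≠ 0 := fun h0 => by
  obtain ⟨f, g, hf, he, hq, -⟩ := h
  have hf0 : toQuot f ≠ 0 := (map_ne_zero_iff _ toQuot_injective).mpr hf
  have hc0 : toQuot (linear c d) ≠ 0 := (map_ne_zero_iff _ toQuot_injective).mpr hcd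
  -- Cross-multiplied form of the two representations, using that `symm f` is central. At a zero of
  -- `pc + d` the right side vanishes, while the left is `fˢ(p)(pa + b) ≠ 0`.
  have e : symm f * linear a b = linear c d * (conj f * g) := by
    apply toQuot_injective
    have e1 : toQuot (linear a b) = toQuot (linear c d) * ((toQuot f)⁻¹ * toQuot g) := by
      rw [← he, linearQuot, mul_inv_cancel_left₀ hc0]
    rw [map_mul, e1, ← mul_assoc, ← map_mul, symm_comm, map_mul, mul_assoc, ← conj_mul_self,
      map_mul, mul_assoc, mul_inv_cancel_left₀ hf0, map_mul, map_mul]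
  have e' := congrArg (fun k => value k p) e
  simp only [value_symm_mul, value_linear_mul_of_root h0, value_linear] at e'
  exact (mul_ne_zero hq (hp h0)) e'

/-- A zero `q` of the conjugate denominator yields the zero `c q̄ c⁻¹` of the denominator itself, of
the same norm. -/
theorem conj_denom_ne_zero {c d q : ℍ[ℝ]} (hcd : ∀ p ∈ unitBall, p * c + d ≠ 0)
    (hq : q ∈ unitBall) : q * star c + star d ≠ 0 := fun h => by
  have h' : c * star q + d = 0 := by simpa using congrArg star h
  by_cases hc : c = 0
  · exact hcd q hq (by simpa [hc] using h')
  · refine hcd (c * star q * c⁻¹) ?_ ?_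
    · have : ‖c‖ ≠ 0 := norm_ne_zero_iff.mpr hc
      simp only [unitBall, mem_ball_zero_iff, norm_mul, norm_inv, norm_star] at hq ⊢
      rwa [mul_comm ‖c‖, mul_assoc, mul_inv_cancel₀ this, mul_one]
    · rwa [inv_mul_cancel_right₀ hc]

theorem inv_mul_mul_mem_unitBall {h q : ℍ[ℝ]} (hh : h ≠ 0) (hq : q ∈ unitBall) :
    h⁻¹ * q * h ∈ unitBall := by
  have : ‖h‖ ≠ 0 := norm_ne_zero_iff.mpr hh
  simp only [unitBall, mem_ball_zero_iff, norm_mul, norm_inv] at hq ⊢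
  rwa [mul_comm, ← mul_assoc, mul_inv_cancel₀ this, one_mul]

/-- The value of a linear quotient at `q` is the value of the corresponding classical fractional
transformation at a suitable conjugate `p` of `q`. -/
theorem hasValue_linearQuot {c d p q : ℍ[ℝ]} (a b : ℍ[ℝ]) (hh : q * star c + star d ≠ 0)
    (hp : q * (q * star c + star d) = (q * star c + star d) * p) (hcd : p * c + d ≠ 0) :
    HasValue (linearQuot a b c d) q ((p * c + d)⁻¹ * (p * a + b)) := by
  have hs : value (symm (linear c d)) q = (q * star c + star d) * (p * c + d) := by
    rw [← conj_mul_self, conj_linear, value_linear_mul_linear hp]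
  refine ⟨linear c d, linear a b, linear_ne_zero hcd, rfl, ?_, ?_⟩
  · rw [hs]; exact mul_ne_zero hh hcd
  · rw [hs, conj_linear, value_linear_mul_linear hp, mul_inv_rev, mul_assoc, inv_mul_cancel_left₀ hh]

theorem exists_hasValue_linearQuot {c d q : ℍ[ℝ]} (a b : ℍ[ℝ])
    (hcd : ∀ p ∈ unitBall, p * c + d ≠ 0) (hq : q ∈ unitBall) :
    ∃ p ∈ unitBall, HasValue (linearQuot a b c d) q ((p * c + d)⁻¹ * (p * a + b)) := by
  have hh := conj_denom_ne_zero hcd hq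
  have hp := inv_mul_mul_mem_unitBall hh hq
  refine ⟨_, hp, hasValue_linearQuot a b hh ?_ (hcd _ hp)⟩
  rw [mul_assoc (_⁻¹), mul_inv_cancel_left₀ hh]

/-- The change of point is inverted by `q = e⁻¹ p e` with `e = pc + d`. This `q` does not depend on
the numerator, so quotients with a common denominator can be compared at a single point. -/
theorem exists_forall_hasValue_linearQuot {c d p : ℍ[ℝ]}
    (hcd : ∀ p ∈ unitBall, p * c + d ≠ 0) (hp : p ∈ unitBall) :
    ∃ q ∈ unitBall, ∀ a b, HasValue (linearQuot a b c d) q ((p * c + d)⁻¹ * (p * a + b)) := by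
  have he := hcd p hp
  have hq := inv_mul_mul_mem_unitBall he hp
  refine ⟨_, hq, fun a b => hasValue_linearQuot a b (conj_denom_ne_zero hcd hq) ?_ he⟩
  generalize he' : p * c + d = e at *
  generalize hq' : e⁻¹ * p * e = q at *
  refine mul_left_cancel₀ he ?_
  have eq : e * q = p * e := by rw [← hq', mul_assoc, mul_inv_cancel_left₀ he]
  -- This is the symmetrization of the denominator evaluated at `p`: a polynomial in `p` with real
  -- coefficients, hence commuting with `p`.
  have eh : e * (q * star c + star d) =
      p * p * (c * star c) + p * (d * star c + star (d * star c)) + d * star d := by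
    rw [mul_add, ← mul_assoc, eq, ← he', star_mul, star_star]; noncomm_ring
  have comm : Commute p (e * (q * star c + star d)) := by
    have hr : ∀ r : ℝ, Commute p (r : ℍ[ℝ]) := fun r => (Quaternion.coe_commute r p).symm
    rw [eh, Quaternion.self_mul_star, Quaternion.self_mul_star, Quaternion.self_add_star']
    exact ((((Commute.refl p).mul_right (Commute.refl p)).mul_right (hr _)).add_right
      ((Commute.refl p).mul_right (hr _))).add_right (hr _)
  rw [← mul_assoc, eq, mul_assoc, comm.eq, mul_assoc]

theorem mapsBallOnto_linearQuot_iff {a b c d : ℍ[ℝ]} (hcd : ∀ p ∈ unitBall, p * c + d ≠ 0) :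
    MapsBallOnto (linearQuot a b c d) ↔
      (fun p => (p * c + d)⁻¹ * (p * a + b)) '' unitBall = unitBall := by
  have him : (toFun (linearQuot a b c d)).image unitBall =
      (fun p => (p * c + d)⁻¹ * (p * a + b)) '' unitBall := by
    ext w
    constructor
    · rintro ⟨q, hq, hw⟩
      obtain ⟨p, hp, hv⟩ := exists_hasValue_linearQuot a b hcd hq
      exact ⟨p, hp, hv.unique (mem_toFun.mp hw)⟩
    · rintro ⟨p, hp, rfl⟩
      obtain ⟨q, hq, hv⟩ := exists_forall_hasValue_linearQuot hcd hp
      exact ⟨q, hq, mem_toFun.mpr (hv a b)⟩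
  rw [MapsBallOnto, him]
  refine and_iff_right fun q hq => ?_
  obtain ⟨p, -, hv⟩ := exists_hasValue_linearQuot a b hcd hq
  exact ⟨_, hv⟩

/-- Whether a quotient maps `𝔹` onto `𝔹` only depends on its values on `𝔹`. -/
theorem MapsBallOnto.congr {φ ψ : RegQuot} (hφ : MapsBallOnto φ)
    (h : ∀ q ∈ unitBall, ∃ w, w ∈ toFun ψ q ∧ w ∈ toFun φ q) : MapsBallOnto ψ := by
  refine ⟨fun q hq => ?_, ?_⟩
  · obtain ⟨w, hw, -⟩ := h q hq
    exact (PFun.mem_dom _ _).mpr ⟨w, hw⟩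
  · refine Eq.trans ?_ hφ.2
    ext w
    constructor
    · rintro ⟨q, hq, hw⟩
      obtain ⟨w', h1, h2⟩ := h q hq
      exact ⟨q, hq, Part.mem_unique h1 hw ▸ h2⟩
    · rintro ⟨q, hq, hw⟩
      obtain ⟨w', h1, h2⟩ := h q hq
      exact ⟨q, hq, Part.mem_unique h2 hw ▸ h1⟩

/-! ### Similitudes of the Hermitian form -/

theorem mem_unitBall_iff {q : ℍ[ℝ]} : q ∈ unitBall ↔ Quaternion.normSq q < 1 := by
  rw [unitBall, mem_ball_zero_iff, Quaternion.normSq_eq_norm_mul_self, ← sq, sq_lt_one_iff₀ (norm_nonneg q)]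

theorem inv_mul_mem_unitBall_iff {v w : ℍ[ℝ]} (hv : v ≠ 0) :
    v⁻¹ * w ∈ unitBall ↔ Quaternion.normSq w < Quaternion.normSq v := by
  have : 0 < Quaternion.normSq v :=
    lt_of_le_of_ne Quaternion.normSq_nonneg (Quaternion.normSq_ne_zero.mpr hv).symm
  rw [mem_unitBall_iff, map_mul, Quaternion.normSq_inv, inv_mul_lt_iff₀ this, mul_one]

/-- `A H Āᵗ = l H`. -/
def IsSimilitude (A : Matrix (Fin 2) (Fin 2) ℍ[ℝ]) (l : ℝ) : Prop :=
  A * formH * Aᴴ = l • formH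

theorem isSimilitude_iff {A : Matrix (Fin 2) (Fin 2) ℍ[ℝ]} {l : ℝ} :
    IsSimilitude A l ↔ Quaternion.normSq (A 0 0) - Quaternion.normSq (A 0 1) = l ∧
      Quaternion.normSq (A 1 1) - Quaternion.normSq (A 1 0) = l ∧
      A 0 0 * star (A 1 0) = A 0 1 * star (A 1 1) := by
  have hc : ∀ x y : ℝ, ((x : ℍ[ℝ]) + -(y : ℍ[ℝ]) = (l : ℍ[ℝ])) ↔ x - y = l := fun x y => by
    rw [← sub_eq_add_neg, ← Quaternion.coe_sub, Quaternion.coe_inj]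
  have hl : l • (1 : ℍ[ℝ]) = (l : ℍ[ℝ]) := by
    rw [← Quaternion.mul_coe_eq_smul, one_mul]
  rw [IsSimilitude, ← Matrix.ext_iff]
  simp only [Fin.forall_fin_two, Matrix.mul_apply, Fin.sum_univ_two, formH, Matrix.conjTranspose_apply,
    Matrix.smul_apply, Matrix.of_apply, Matrix.cons_val', Matrix.cons_val_zero, Matrix.cons_val_one,
    Matrix.cons_val_fin_one, mul_one, mul_zero, add_zero, zero_add, mul_neg, neg_mul,
    Quaternion.self_mul_star, smul_zero, smul_neg, hl, hc]
  constructor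
  · rintro ⟨⟨h1, h2⟩, h3, h4⟩
    refine ⟨h1, ?_, ?_⟩
    · rw [← hc, ← neg_inj, ← h4, neg_add, neg_neg, add_comm]
    · rwa [← sub_eq_add_neg, sub_eq_zero] at h2
  · rintro ⟨h1, h2, h3⟩
    refine ⟨⟨h1, by rw [h3]; abel⟩, ?_, ?_⟩
    · have := congrArg star h3
      simp only [star_mul, star_star] at this
      rw [this]; abel
    · rw [← (hc _ _).mpr h2]; abel

theorem formH_mul_formH : formH * formH = 1 := by
  ext i j : 1
  fin_cases i <;> fin_cases j <;> simp [formH, Matrix.mul_apply]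

/-- As `H² = 1`, both conditions say that `H Āᵗ H` is the inverse of `A`, once on the left and once
on the right. The second version suits the action on rows `(x, y)A`. -/
theorem mem_Sp11_iff {A : Matrix.GeneralLinearGroup (Fin 2) ℍ[ℝ]} :
    A ∈ Sp11 ↔ IsSimilitude A.1 1 := by
  change A.1ᴴ * formH * A.1 = formH ↔ A.1 * formH * A.1ᴴ = (1 : ℝ) • formH
  rw [one_smul]
  have e1 : A.1ᴴ * formH * A.1 = formH ↔ formH * A.1ᴴ * formH * A.1 = 1 := by
    constructor <;> intro h
    · rw [mul_assoc, mul_assoc, ← mul_assoc A.1ᴴ, h, formH_mul_formH]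
    · have := congrArg (formH * ·) h
      simpa only [← mul_assoc, formH_mul_formH, one_mul, mul_one] using this
  have e2 : A.1 * formH * A.1ᴴ = formH ↔ A.1 * (formH * A.1ᴴ * formH) = 1 := by
    constructor <;> intro h
    · rw [← mul_assoc, ← mul_assoc, h, formH_mul_formH]
    · have := congrArg (· * formH) h
      simpa only [mul_assoc, formH_mul_formH, one_mul, mul_one] using this
  rw [e1, e2, Units.mul_eq_one_iff_eq_inv, Units.mul_eq_one_iff_inv_eq, eq_comm]

/-- The Hermitian form of signature `(1, 1)` in the coordinates given by the rows of a matrix. -/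
theorem normSq_sub_normSq (x y a b c d : ℍ[ℝ]) :
    Quaternion.normSq (x * c + y * d) - Quaternion.normSq (x * a + y * b) =
      Quaternion.normSq x * (Quaternion.normSq c - Quaternion.normSq a) +
      2 * (x * (c * star d - a * star b) * star y).re +
      Quaternion.normSq y * (Quaternion.normSq d - Quaternion.normSq b) := by
  have e : x * (c * star d - a * star b) * star y =
      x * c * star (y * d) - x * a * star (y * b) := by
    simp only [star_mul]; noncomm_ring
  rw [Quaternion.normSq_add, Quaternion.normSq_add, e, Quaternion.re_sub]
  simp only [map_mul]
  ring

theorem IsSimilitude.normSq_sub_normSq {A : Matrix (Fin 2) (Fin 2) ℍ[ℝ]} {l : ℝ}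
    (hA : IsSimilitude A l) (x y : ℍ[ℝ]) :
    Quaternion.normSq (x * A 0 1 + y * A 1 1) - Quaternion.normSq (x * A 0 0 + y * A 1 0) =
      l * (Quaternion.normSq y - Quaternion.normSq x) := by
  obtain ⟨h1, h2, h3⟩ := isSimilitude_iff.mp hA
  rw [RegularQuaternionic.normSq_sub_normSq, h3, sub_self, mul_zero, zero_mul, h2, ← neg_sub, h1]
  simp only [Quaternion.re_zero]
  ring

/-! ### Fractional transformations preserving the ball -/

theorem exists_row_mul_eq (A : Matrix.GeneralLinearGroup (Fin 2) ℍ[ℝ]) (v w : ℍ[ℝ]) :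
    ∃ x y, x * A.1 0 0 + y * A.1 1 0 = v ∧ x * A.1 0 1 + y * A.1 1 1 = w := by
  have h : (![v, w] ᵥ* A⁻¹.1) ᵥ* A.1 = ![v, w] := by
    rw [Matrix.vecMul_vecMul, A.inv_mul, Matrix.vecMul_one]
  have h0 := congrFun h 0
  have h1 := congrFun h 1
  simp only [Matrix.vecMul, dotProduct, Fin.sum_univ_two] at h0 h1
  exact ⟨_, _, h0, h1⟩

theorem eq_zero_of_row_mul_eq_zero (A : Matrix.GeneralLinearGroup (Fin 2) ℍ[ℝ]) {x y : ℍ[ℝ]}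
    (h0 : x * A.1 0 0 + y * A.1 1 0 = 0) (h1 : x * A.1 0 1 + y * A.1 1 1 = 0) :
    x = 0 ∧ y = 0 := by
  have h : ![x, y] ᵥ* A.1 = 0 := by
    ext i : 1
    fin_cases i
    · simpa [Matrix.vecMul, dotProduct, Fin.sum_univ_two] using h0
    · simpa [Matrix.vecMul, dotProduct, Fin.sum_univ_two] using h1
  have h' : ![x, y] = 0 := by
    rw [← Matrix.vecMul_one ![x, y], ← A.mul_inv, ← Matrix.vecMul_vecMul, h, Matrix.zero_vecMul]
  exact ⟨congrFun h' 0, congrFun h' 1⟩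

/-- Equal values mean that the rows `(p, 1)A` and `(p', 1)A` are left proportional; invertibility of
`A` forces the ratio `x` to be `1`. -/
theorem fractional_injective (A : Matrix.GeneralLinearGroup (Fin 2) ℍ[ℝ]) {p p' : ℍ[ℝ]}
    (hp : p * A.1 0 1 + A.1 1 1 ≠ 0) (hp' : p' * A.1 0 1 + A.1 1 1 ≠ 0)
    (h : (p * A.1 0 1 + A.1 1 1)⁻¹ * (p * A.1 0 0 + A.1 1 0) =
      (p' * A.1 0 1 + A.1 1 1)⁻¹ * (p' * A.1 0 0 + A.1 1 0)) : p = p' := by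
  set x := (p' * A.1 0 1 + A.1 1 1) * (p * A.1 0 1 + A.1 1 1)⁻¹ with hx
  have e1 : x * (p * A.1 0 1 + A.1 1 1) = p' * A.1 0 1 + A.1 1 1 := by
    rw [hx, inv_mul_cancel_right₀ hp]
  have e0 : x * (p * A.1 0 0 + A.1 1 0) = p' * A.1 0 0 + A.1 1 0 := by
    rw [hx, mul_assoc, h, mul_inv_cancel_left₀ hp']
  obtain ⟨h1, h2⟩ := eq_zero_of_row_mul_eq_zero A (x := x * p - p') (y := x - 1)
    (by rw [← sub_eq_zero.mpr e0]; noncomm_ring) (by rw [← sub_eq_zero.mpr e1]; noncomm_ring)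
  rw [sub_eq_zero.mp h2, one_mul] at h1
  exact sub_eq_zero.mp h1

theorem IsSimilitude.mapsBallOnto {A : Matrix.GeneralLinearGroup (Fin 2) ℍ[ℝ]} {l : ℝ}
    (hl : 0 < l) (hA : IsSimilitude A.1 l) : MapsBallOnto (regFrac A) := by
  have hQ := fun p : ℍ[ℝ] => hA.normSq_sub_normSq p 1
  simp only [one_mul, map_one] at hQ
  have hcd : ∀ p ∈ unitBall, p * A.1 0 1 + A.1 1 1 ≠ 0 := fun p hp h => by
    have := hQ p
    rw [h, map_zero] at this
    have := mul_pos hl (sub_pos.mpr (mem_unitBall_iff.mp hp))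
    have := Quaternion.normSq_nonneg (a := p * A.1 0 0 + A.1 1 0)
    linarith
  rw [regFrac_eq_linearQuot, mapsBallOnto_linearQuot_iff hcd]
  refine Set.Subset.antisymm ?_ fun w hw => ?_
  · rintro _ ⟨p, hp, rfl⟩
    refine (inv_mul_mem_unitBall_iff (hcd p hp)).mpr ?_
    have := hQ p
    have := mul_pos hl (sub_pos.mpr (mem_unitBall_iff.mp hp))
    linarith
  -- Solve `(x, y)A = (w, 1)`. Positivity of the form on this row gives `|x| < |y|`, so `y⁻¹x` is a
  -- preimage in the ball.
  · obtain ⟨x, y, h0, h1⟩ := exists_row_mul_eq A w 1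
    have h := hA.normSq_sub_normSq x y
    rw [h0, h1, map_one] at h
    have hyx : 0 < Quaternion.normSq y - Quaternion.normSq x :=
      (mul_pos_iff_of_pos_left hl).mp (h ▸ sub_pos.mpr (mem_unitBall_iff.mp hw))
    have hy : y ≠ 0 := fun hy => by
      rw [hy, map_zero] at hyx
      linarith [Quaternion.normSq_nonneg (a := x)]
    have e0 : y⁻¹ * x * A.1 0 0 + A.1 1 0 = y⁻¹ * w := by
      rw [← h0, mul_add, inv_mul_cancel_left₀ hy, mul_assoc]
    have e1 : y⁻¹ * x * A.1 0 1 + A.1 1 1 = y⁻¹ := by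
      have := congrArg (y⁻¹ * ·) h1
      simpa only [mul_add, inv_mul_cancel_left₀ hy, mul_one, ← mul_assoc] using this
    refine ⟨y⁻¹ * x, (inv_mul_mem_unitBall_iff hy).mpr (sub_pos.mp hyx), ?_⟩
    change (y⁻¹ * x * A.1 0 1 + A.1 1 1)⁻¹ * (y⁻¹ * x * A.1 0 0 + A.1 1 0) = w
    rw [e0, e1, inv_inv, mul_inv_cancel_left₀ hy]

theorem denom_ne_zero_of_mapsBallOnto {A : Matrix.GeneralLinearGroup (Fin 2) ℍ[ℝ]}
    (h : MapsBallOnto (regFrac A)) : ∀ p ∈ unitBall, p * A.1 0 1 + A.1 1 1 ≠ 0 := fun p hp => by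
  obtain ⟨w, hw⟩ := (PFun.mem_dom _ _).mp (h.1 hp)
  have hne : ∀ p, p * A.1 0 1 + A.1 1 1 = 0 → p * A.1 0 0 + A.1 1 0 ≠ 0 := fun p h1 h0 =>
    one_ne_zero (eq_zero_of_row_mul_eq_zero A (x := p) (y := (1 : ℍ[ℝ])) (by rwa [one_mul])
      (by rwa [one_mul])).2
  refine HasValue.denom_ne_zero ?_ (hne p) (mem_toFun.mp hw)
  intro h0
  have hv : ∀ q : ℍ[ℝ], q * A.1 0 1 + A.1 1 1 = 0 := fun q => by
    rw [← value_linear, h0]; simp [value, coef]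
  have hd : A.1 1 1 = 0 := by simpa using hv 0
  have hc : A.1 0 1 = 0 := by simpa [hd] using hv 1
  obtain ⟨x, y, -, h1⟩ := exists_row_mul_eq A 0 1
  simp [hc, hd] at h1

/-- If a quadratic function `k |p|² + 2 Re (p m) + n` is positive exactly on the unit ball, then it
is a positive multiple of `1 - |p|²`. -/
theorem eq_of_pos_iff_mem_unitBall {k n : ℝ} {m : ℍ[ℝ]}
    (h : ∀ p : ℍ[ℝ], p ∈ unitBall ↔ 0 < Quaternion.normSq p * k + 2 * (p * m).re + n) :
    0 < n ∧ k = -n ∧ m = 0 := by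
  have hn : 0 < n := by simpa using (h 0).mp (by simp [unitBall])
  have hcont : Continuous fun p : ℍ[ℝ] => Quaternion.normSq p * k + 2 * (p * m).re + n :=
    ((Quaternion.continuous_normSq.mul continuous_const).add (continuous_const.mul
      (Quaternion.continuous_re.comp (continuous_id.mul continuous_const)))).add continuous_const
  have hsph : ∀ p : ℍ[ℝ], ‖p‖ = 1 → k + 2 * (p * m).re + n = 0 := fun p hp => by
    -- On the sphere the function is nonnegative by continuity from inside and nonpositive because
    -- the sphere misses the open ball.
    have hle : p ∈ closure unitBall := by
      rw [unitBall, closure_ball _ one_ne_zero, mem_closedBall_zero_iff, hp]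
    have h1 := closure_minimal (t := {p | 0 ≤ Quaternion.normSq p * k + 2 * (p * m).re + n})
      (fun q hq => ((h q).mp hq).le) (isClosed_le continuous_const hcont) hle
    have h2 : ¬ p ∈ unitBall := by simp [unitBall, hp]
    rw [h, not_lt] at h2
    have h3 := le_antisymm h2 h1
    rwa [Quaternion.normSq_eq_norm_mul_self, hp, one_mul, one_mul] at h3
  -- Comparing `p` with `-p` isolates the linear term; the unit vector `m̄ / |m|` then detects `m`.
  have hre : ∀ p : ℍ[ℝ], ‖p‖ = 1 → (p * m).re = 0 := fun p hp => by
    have h1 := hsph p hp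
    have h2 := hsph (-p) (by rwa [norm_neg])
    rw [neg_mul, Quaternion.re_neg] at h2
    linarith
  refine ⟨hn, ?_, ?_⟩
  · have h1 := hsph 1 norm_one
    rw [hre 1 norm_one] at h1
    linarith
  · by_contra hm
    have hm' : ‖m‖ ≠ 0 := norm_ne_zero_iff.mpr hm
    have := hre (‖m‖⁻¹ • star m) (by
      rw [norm_smul, norm_star, norm_inv, norm_norm, inv_mul_cancel₀ hm'])
    rw [smul_mul_assoc, Quaternion.star_mul_self, Quaternion.re_smul, Quaternion.re_coe, smul_eq_mul] at this
    exact mul_ne_zero (inv_ne_zero hm') (Quaternion.normSq_ne_zero.mpr hm) this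

theorem exists_isSimilitude_of_mapsBallOnto {A : Matrix.GeneralLinearGroup (Fin 2) ℍ[ℝ]}
    (h : MapsBallOnto (regFrac A)) : ∃ l > 0, IsSimilitude A.1 l := by
  have hcd := denom_ne_zero_of_mapsBallOnto h
  rw [regFrac_eq_linearQuot, mapsBallOnto_linearQuot_iff hcd] at h
  have hiff : ∀ p : ℍ[ℝ], p ∈ unitBall ↔
      Quaternion.normSq (p * A.1 0 0 + A.1 1 0) < Quaternion.normSq (p * A.1 0 1 + A.1 1 1) := by
    refine fun p => ⟨fun hp => ?_, fun hp => ?_⟩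
    · rw [← inv_mul_mem_unitBall_iff (hcd p hp), ← h]
      exact ⟨p, hp, rfl⟩
    -- A point with positive form has its image in the ball, where the value is also attained by
    -- some `p'` of the ball; injectivity gives `p = p'`.
    · have hne : p * A.1 0 1 + A.1 1 1 ≠ 0 := fun h0 => by
        rw [h0, map_zero] at hp
        exact hp.not_ge Quaternion.normSq_nonneg
      rw [← inv_mul_mem_unitBall_iff hne, ← h] at hp
      obtain ⟨p', hp', he⟩ := hp
      rwa [← fractional_injective A (hcd p' hp') hne he]
  obtain ⟨hn, hk, hm⟩ := eq_of_pos_iff_mem_unitBall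
    (k := Quaternion.normSq (A.1 0 1) - Quaternion.normSq (A.1 0 0))
    (n := Quaternion.normSq (A.1 1 1) - Quaternion.normSq (A.1 1 0))
    (m := A.1 0 1 * star (A.1 1 1) - A.1 0 0 * star (A.1 1 0)) fun p => by
      have := normSq_sub_normSq p 1 (A.1 0 0) (A.1 1 0) (A.1 0 1) (A.1 1 1)
      simp only [one_mul, map_one, star_one, mul_one] at this
      rw [hiff, ← this, sub_pos]
  exact ⟨_, hn, isSimilitude_iff.mpr ⟨by linarith, rfl, (sub_eq_zero.mp hm).symm⟩⟩

/-! ### The similitude factor and the Dieudonné determinant -/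

theorem IsSimilitude.normSq_diag_eq {A : Matrix (Fin 2) (Fin 2) ℍ[ℝ]} {l : ℝ}
    (hl : l ≠ 0) (hA : IsSimilitude A l) : Quaternion.normSq (A 0 0) = Quaternion.normSq (A 1 1) := by
  obtain ⟨h1, h2, h3⟩ := isSimilitude_iff.mp hA
  have h := congrArg Quaternion.normSq h3
  rw [map_mul, map_mul, Quaternion.normSq_star, Quaternion.normSq_star] at h
  refine mul_left_cancel₀ hl ?_
  linear_combination -h - Quaternion.normSq (A 0 0) * h2 + Quaternion.normSq (A 1 1) * h1

theorem IsSimilitude.dieudonneDet_eq {A : Matrix (Fin 2) (Fin 2) ℍ[ℝ]} {l : ℝ} (hl : 0 < l)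
    (hA : IsSimilitude A l) : dieudonneDet A = l := by
  have hd := hA.normSq_diag_eq hl.ne'
  obtain ⟨h1, h2, h3⟩ := isSimilitude_iff.mp hA
  have ha : A 0 0 ≠ 0 := fun ha => by
    rw [ha, map_zero] at h1
    linarith [Quaternion.normSq_nonneg (a := A 0 1)]
  have hn : Quaternion.normSq (A 0 0) ≠ 0 := Quaternion.normSq_ne_zero.mpr ha
  have hb : A 1 0 * star (A 0 0) = A 1 1 * star (A 0 1) := by
    simpa only [star_mul, star_star] using congrArg star h3
  have e : A 0 0 * A 1 1 - A 0 0 * A 1 0 * (A 0 0)⁻¹ * A 0 1 =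
      ((Quaternion.normSq (A 0 0))⁻¹ * l) • (A 0 0 * A 1 1) := by
    -- Since `b ā = d c̄`, one has `a b a⁻¹ c = |a|⁻² a b ā c = |a|⁻² |c|² a d`.
    have : A 0 0 * A 1 0 * (A 0 0)⁻¹ * A 0 1 =
        ((Quaternion.normSq (A 0 0))⁻¹ * Quaternion.normSq (A 0 1)) • (A 0 0 * A 1 1) := by
      rw [Quaternion.inv_def, mul_smul_comm, smul_mul_assoc, mul_assoc (A 0 0), hb, mul_assoc,
        mul_assoc, Quaternion.star_mul_self, mul_smul, ← Quaternion.mul_coe_eq_smul (Quaternion.normSq (A 0 1)),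
        mul_assoc]
    rw [this, ← h1, mul_sub, inv_mul_cancel₀ hn, sub_smul, one_smul]
  rw [dieudonneDet, if_neg ha, e, norm_smul, norm_mul (A 0 0)]
  have hnorm : ‖A 0 0‖ = ‖A 1 1‖ := by
    rw [Quaternion.normSq_eq_norm_mul_self, Quaternion.normSq_eq_norm_mul_self] at hd
    exact (mul_self_inj (norm_nonneg _) (norm_nonneg _)).mp hd
  rw [← hnorm, ← Quaternion.normSq_eq_norm_mul_self, Real.norm_of_nonneg
    (mul_nonneg (inv_nonneg.mpr Quaternion.normSq_nonneg) hl.le)]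
  field_simp

theorem mem_Sp11_of_mapsBallOnto {A : Matrix.GeneralLinearGroup (Fin 2) ℍ[ℝ]} (hA : A ∈ SL2)
    (h : MapsBallOnto (regFrac A)) : A ∈ Sp11 := by
  obtain ⟨l, hl, hs⟩ := exists_isSimilitude_of_mapsBallOnto h
  have h1 : l = 1 := (hs.dieudonneDet_eq hl).symm.trans hA
  exact mem_Sp11_iff.mpr (h1 ▸ hs)

/-- Multiplying `A` by the real number `1/√l` brings the factor `l` to `1` and cancels in the
quotient. -/
theorem exists_mem_Sp11_of_mapsBallOnto {A : Matrix.GeneralLinearGroup (Fin 2) ℍ[ℝ]}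
    (h : MapsBallOnto (regFrac A)) : ∃ C ∈ Sp11, regFrac C = regFrac A := by
  obtain ⟨l, hl, hs⟩ := exists_isSimilitude_of_mapsBallOnto h
  have hr : (√l)⁻¹ ≠ 0 := inv_ne_zero (Real.sqrt_ne_zero'.mpr hl)
  have hrl : (√l)⁻¹ ^ 2 * l = 1 := by rw [inv_pow, Real.sq_sqrt hl.le, inv_mul_cancel₀ hl.ne']
  obtain ⟨h1, h2, h3⟩ := isSimilitude_iff.mp hs
  refine ⟨Units.mk0 (√l)⁻¹ hr • A, mem_Sp11_iff.mpr (isSimilitude_iff.mpr ?_), ?_⟩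
  · simp only [Units.val_smul, Units.smul_mk0, Matrix.smul_apply, Quaternion.normSq_smul,
      Quaternion.star_smul, smul_mul_assoc, mul_smul_comm, h3, ← mul_sub, h1, h2, hrl, and_self]
  · have hz : (((√l)⁻¹ : ℝ) : ℍ[ℝ]) ≠ 0 := fun h0 => hr (Quaternion.coe_injective h0)
    rw [regFrac_eq_linearQuot, regFrac_eq_linearQuot, ← linearQuot_mul_left hz (A.1 0 0)]
    simp only [Units.val_smul, Units.smul_mk0, Matrix.smul_apply, Quaternion.coe_mul_eq_smul]

/-! ### The normal form and its parameters -/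

theorem moebius_denom_ne_zero {a : ℍ[ℝ]} (ha : a ∈ unitBall) :
    ∀ p ∈ unitBall, p * -star a + 1 ≠ 0 := fun p hp h => by
  simp only [unitBall, mem_ball_zero_iff] at ha hp
  have h1 : p * star a = 1 := by rw [mul_neg, neg_add_eq_zero] at h; exact h
  have h2 := congrArg norm h1
  rw [norm_mul, norm_star, norm_one] at h2
  exact (mul_lt_one_of_nonneg_of_lt_one_left (norm_nonneg p) hp ha.le).ne h2

theorem regFrac_eq_moebius {A : Matrix.GeneralLinearGroup (Fin 2) ℍ[ℝ]} (hA : A ∈ Sp11) :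
    ∃ u a : ℍ[ℝ], ‖u‖ = 1 ∧ a ∈ unitBall ∧ regFrac A = moebius a u := by
  have hs := mem_Sp11_iff.mp hA
  have hn := hs.normSq_diag_eq one_ne_zero
  obtain ⟨h1, h2, -⟩ := isSimilitude_iff.mp hs
  -- The column relation from `Āᵗ H A = H`; it makes the remaining entry `d⁻¹b` equal to the `-(a *
  -- u)` that the normal form requires.
  have hcol : star (A.1 0 1) * A.1 0 0 = star (A.1 1 1) * A.1 1 0 := by
    have := congrFun (congrFun (show A.1ᴴ * formH * A.1 = formH from hA) 1) 0
    simpa [Matrix.mul_apply, Fin.sum_univ_two, formH, ← sub_eq_add_neg, sub_eq_zero] using this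
  have hd : A.1 1 1 ≠ 0 := fun hd => by
    rw [hd, map_zero] at h2
    linarith [Quaternion.normSq_nonneg (a := A.1 1 0)]
  have hd' : ‖A.1 1 1‖ ≠ 0 := norm_ne_zero_iff.mpr hd
  have hnorm : ‖A.1 0 0‖ = ‖A.1 1 1‖ := by
    rw [Quaternion.normSq_eq_norm_mul_self, Quaternion.normSq_eq_norm_mul_self] at hn
    exact (mul_self_inj (norm_nonneg _) (norm_nonneg _)).mp hn
  refine ⟨(A.1 1 1)⁻¹ * A.1 0 0, -star ((A.1 1 1)⁻¹ * A.1 0 1), ?_, ?_, ?_⟩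
  · rw [norm_mul, norm_inv, hnorm, inv_mul_cancel₀ hd']
  · rw [mem_unitBall_iff, Quaternion.normSq_neg, Quaternion.normSq_star, ← mem_unitBall_iff,
      inv_mul_mem_unitBall_iff hd]
    linarith
  · have hb : -(-star ((A.1 1 1)⁻¹ * A.1 0 1) * ((A.1 1 1)⁻¹ * A.1 0 0)) =
        (A.1 1 1)⁻¹ * A.1 1 0 := by
      rw [neg_mul, neg_neg, star_mul, Quaternion.inv_def, Quaternion.star_smul, star_star,
        mul_smul_comm, smul_mul_assoc, smul_mul_assoc, smul_mul_assoc, mul_smul_comm, ← hcol,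
        mul_assoc, ← mul_assoc (A.1 1 1), Quaternion.self_mul_star, Quaternion.coe_mul_eq_smul,
        mul_smul_comm, smul_smul, smul_smul, mul_assoc,
        inv_mul_cancel₀ (Quaternion.normSq_ne_zero.mpr hd), mul_one]
    rw [moebius_eq_linearQuot, hb, star_neg, star_star, neg_neg, regFrac_eq_linearQuot,
      ← linearQuot_mul_left (inv_ne_zero hd), inv_mul_cancel₀ hd]

/-- A point where the regular Moebius transformation with centre `b` vanishes is `b`. -/
theorem eq_of_hasValue_moebius_zero {a b u : ℍ[ℝ]} (ha : a ∈ unitBall) (hb : b ∈ unitBall)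
    (hu : u ≠ 0) (h : HasValue (moebius b u) a 0) : a = b := by
  have hden := moebius_denom_ne_zero hb
  have hh := conj_denom_ne_zero hden ha
  have hp := inv_mul_mul_mem_unitBall hh ha
  have hcomm : a * (a * star (-star b) + star 1) = (a * star (-star b) + star 1) *
      ((a * star (-star b) + star 1)⁻¹ * a * (a * star (-star b) + star 1)) := by
    rw [mul_assoc (_⁻¹), mul_inv_cancel_left₀ hh]
  rw [moebius_eq_linearQuot] at h
  have h0 := h.unique (hasValue_linearQuot _ _ hh hcomm (hden _ hp))
  have h1 := (mul_eq_zero.mp h0.symm).resolve_left (inv_ne_zero (hden _ hp))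
  rw [← neg_mul, ← add_mul] at h1
  have h2 := add_neg_eq_zero.mp ((mul_eq_zero.mp h1).resolve_right hu)
  rw [h2, star_neg, star_star, star_one] at hcomm
  -- The zero is at the conjugate point `p = b`, so `a(1 - ab) = (1 - ab)b`. Taking norms in the
  -- rearranged identity forces `a = b`, because `|a||b| < 1`.
  have h3 : a - b = a * (a - b) * b := by
    rw [← sub_eq_zero, ← sub_eq_zero.mpr hcomm]; noncomm_ring
  have h4 := congrArg norm h3
  rw [norm_mul, norm_mul] at h4
  simp only [unitBall, mem_ball_zero_iff] at ha hb
  by_contra hne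
  have h5 : 0 < ‖a - b‖ := norm_sub_pos_iff.mpr hne
  have h6 : ‖a‖ * ‖b‖ < 1 := mul_lt_one_of_nonneg_of_lt_one_left (norm_nonneg a) ha hb.le
  nlinarith

theorem hasValue_moebius_self {a : ℍ[ℝ]} (ha : a ∈ unitBall) (u : ℍ[ℝ]) :
    HasValue (moebius a u) a 0 := by
  have hden := moebius_denom_ne_zero ha
  rw [moebius_eq_linearQuot]
  -- At `q = a` the conjugating factor is `1 - a²`, which commutes with `a`, so `p = a`.
  convert hasValue_linearQuot u (-(a * u)) (conj_denom_ne_zero hden ha) (p := a) ?_ (hden a ha) using 1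
  · rw [add_neg_cancel, mul_zero]
  · rw [star_neg, star_star, star_one]; noncomm_ring

theorem moebius_params_unique {a b u v : ℍ[ℝ]} (ha : a ∈ unitBall) (hb : b ∈ unitBall)
    (hv : v ≠ 0)
    (h : ∀ q ∈ unitBall, ∃ w, w ∈ toFun (moebius a u) q ∧ w ∈ toFun (moebius b v) q) :
    a = b ∧ u = v := by
  have hab : a = b := by
    obtain ⟨w, h1, h2⟩ := h a ha
    rw [mem_toFun] at h1 h2
    rw [h1.unique (hasValue_moebius_self ha u)] at h2
    exact eq_of_hasValue_moebius_zero ha hb hv h2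
  subst hab
  refine ⟨rfl, ?_⟩
  -- Any `p ≠ a` in the ball will do: the two values agree there, so `(p - a)u = (p - a)v`, and `p -
  -- a` cancels.
  obtain ⟨p, hp, hpa⟩ : ∃ p ∈ unitBall, p ≠ a := by
    by_cases h0 : a = 0
    · refine ⟨((1 / 2 : ℝ) : ℍ[ℝ]), ?_, ?_⟩
      · rw [mem_unitBall_iff, Quaternion.normSq_coe]; norm_num
      · rw [h0]; exact fun h1 => by simpa using Quaternion.coe_injective h1
    · exact ⟨0, by simp [unitBall], Ne.symm h0⟩
  have hden := moebius_denom_ne_zero ha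
  obtain ⟨q, hq, hval⟩ := exists_forall_hasValue_linearQuot hden hp
  obtain ⟨w, h1, h2⟩ := h q hq
  rw [mem_toFun, moebius_eq_linearQuot] at h1 h2
  have he := (hval _ _).unique h1 |>.trans ((hval _ _).unique h2).symm
  have he' := mul_left_cancel₀ (inv_ne_zero (hden p hp)) he
  rw [← neg_mul, ← neg_mul, ← add_mul, ← add_mul] at he'
  exact mul_left_cancel₀ (fun h0 => hpa (add_neg_eq_zero.mp h0)) he'

/-- The coefficient matrix is a similitude with factor `1 - |a|²`, generally not `1`, so it is
handled without normalization. The similitude relation itself supplies the inverse `l⁻¹ H Mᴴ H`. -/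
theorem mapsBallOnto_moebius {a u : ℍ[ℝ]} (hu : ‖u‖ = 1) (ha : a ∈ unitBall) :
    MapsBallOnto (moebius a u) := by
  have hu' : Quaternion.normSq u = 1 := by rw [Quaternion.normSq_eq_norm_mul_self, hu, one_mul]
  have hl : 0 < 1 - Quaternion.normSq a := sub_pos.mpr (mem_unitBall_iff.mp ha)
  have hs : IsSimilitude !![u, -star a; -(a * u), 1] (1 - Quaternion.normSq a) := by
    refine isSimilitude_iff.mpr ⟨?_, ?_, ?_⟩
    · simp [hu']
    · simp [hu']
    · simp [← mul_assoc, Quaternion.self_mul_star, hu']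
  generalize hM : !![u, -star a; -(a * u), 1] = M at hs
  have hinv : M * ((1 - Quaternion.normSq a)⁻¹ • (formH * Mᴴ * formH)) = 1 := by
    rw [mul_smul_comm, ← mul_assoc, ← mul_assoc, show M * formH * Mᴴ = _ from hs, smul_mul_assoc,
      formH_mul_formH, smul_smul, inv_mul_cancel₀ hl.ne', one_smul]
  have h := IsSimilitude.mapsBallOnto (A := ⟨M, _, hinv, mul_eq_one_comm.mp hinv⟩) hl hs
  rw [regFrac_eq_linearQuot] at h
  subst hM
  rw [moebius_eq_linearQuot]
  exact h

end RegularQuaternionic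

end

/-! ### The equivalences and the orbit description -/

theorem mainTheorem6 :
    (∀ A ∈ SL2,
      List.TFAE
        [MapsBallOnto (regFrac A),
          A ∈ Sp11,
          ∃ u a : ℍ[ℝ], ‖u‖ = 1 ∧ a ∈ unitBall ∧
            ∀ q ∈ unitBall, ∃ w, w ∈ toFun (regFrac A) q ∧ w ∈ toFun (moebius a u) q,
          ∃! p : ℍ[ℝ] × ℍ[ℝ], ‖p.1‖ = 1 ∧ p.2 ∈ unitBall ∧
            ∀ q ∈ unitBall, ∃ w, w ∈ toFun (regFrac A) q ∧ w ∈ toFun (moebius p.2 p.1) q]) ∧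
    regMoebius = orbit (toQuot ident) Sp11 := by
  refine ⟨fun A hA => ?_, ?_⟩
  · tfae_have 1 → 2 := mem_Sp11_of_mapsBallOnto hA
    tfae_have 2 → 1 := fun h => (mem_Sp11_iff.mp h).mapsBallOnto one_pos
    tfae_have 2 → 4 := by
      intro h
      obtain ⟨u, a, hu, ha, he⟩ := regFrac_eq_moebius h
      have hdef : ∀ q ∈ unitBall, ∃ w, w ∈ toFun (regFrac A) q := fun q hq =>
        (PFun.mem_dom _ _).mp (((mem_Sp11_iff.mp h).mapsBallOnto one_pos).1 hq)
      refine ⟨(u, a), ⟨hu, ha, fun q hq => ?_⟩, ?_⟩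
      · obtain ⟨w, hw⟩ := hdef q hq
        exact ⟨w, hw, he ▸ hw⟩
      · rintro ⟨v, b⟩ ⟨hv, hb, hvb⟩
        have hv0 : v ≠ 0 := norm_ne_zero_iff.mp (by rw [hv]; exact one_ne_zero)
        obtain ⟨rfl, rfl⟩ := moebius_params_unique ha hb hv0 (he ▸ hvb)
        rfl
    tfae_have 4 → 3 := fun ⟨p, ⟨hu, ha, h⟩, _⟩ => ⟨p.1, p.2, hu, ha, h⟩
    tfae_have 3 → 1 := by
      rintro ⟨u, a, hu, ha, h⟩
      exact (mapsBallOnto_moebius hu ha).congr h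
    tfae_finish
  · ext φ
    constructor
    · rintro ⟨⟨A, rfl⟩, h⟩
      -- `A` is an arbitrary invertible matrix here, so it is replaced by a rescaled representative
      -- in `Sp11` of the same quotient.
      obtain ⟨C, hC, he⟩ := exists_mem_Sp11_of_mapsBallOnto h
      exact ⟨C, hC, by rw [act_ident, he]⟩
    · rintro ⟨A, hA, rfl⟩
      rw [act_ident]
      exact ⟨⟨A, rfl⟩, (mem_Sp11_iff.mp hA).mapsBallOnto one_pos⟩
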